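/- Let $\gamma>0$ and $\alpha=2/\gamma^2$, let $dA$ be Lebesgue measure on $\mathbb C$, and put $$dA_\alpha(z)=\tfrac{\alpha}{\pi}e^{-\alpha|z|^2}\,dA(z),\qquad d\mu_\gamma(z)=\tfrac{2}{\pi\gamma^2}\exp\Big(\tfrac{(z-\overline z)^2}{\gamma^2}\Big)\,dA(z).$$ The Fock space $\mathcal F_\alpha$ is the space of entire functions in $L^2(\mathbb C,dA_\alpha)$, and the RBF space $\mathcal H_\gamma$ is the space of entire functions in $L^2(\mathbb C,d\mu_\gamma)$. Let $\mathcal M f(z)=e^{z^2/\gamma^2}f(z)$, and let $$B_\alpha\varphi(z)=\Big(\frac{\alpha}{\pi}\Big)^{1/4}\int_{\mathbb R}e^{-\frac{\alpha}{2}(z^2+x^2)+\sqrt2\,\alpha zx}\,\varphi(x)\,dx,\qquad \varphi\in L^2(\mathbb R),$$ be the classical Segal–Bargmann transform. Let $e_n^\gamma(z)=\sqrt{\frac{2^n}{\gamma^{2n}n!}}\,z^n e^{-z^2/\gamma^2}$, let $\psi_n^\alpha(x)=(\alpha/\pi)^{1/4}(2^nn!)^{-1/2}H_n(\sqrt\alpha\,x)e^{-\alpha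 x^2/2}$ be the $L^2(\mathbb R)$-normalized Hermite functions ($H_n$ being the physicists' Hermite polynomials), and let $$\mathfrak B^\gamma_{RBF}\varphi(z)=\int_{\mathbb R}\Big(\sum_{n\ge0}e_n^\gamma(z)\psi_n^\alpha(x)\Big)\varphi(x)\,dx,\qquad \varphi\in L^2(\mathbb R).$$ Finally, let $\mathcal A^\gamma_{RBF}(z,x)=\exp\big(-\frac{(x-\sqrt2\,z)^2}{\gamma^2}\big)$. Then $\sum_{n\ge0}e_n^\gamma(z)\psi_n^\alpha(x)=\big(\frac{2}{\pi\gamma^2}\big)^{1/4}\mathcal A^\gamma_{RBF}(z,x)$ for all $z\in\mathbb C$, $x\in\mathbb R$. The maps $B_\alpha:L^2(\mathbb R)\to\mathcal F_\alpha$, $\mathfrak B^\gamma_{RBF}:L^2(\mathbb R)\to\mathcal H_\gamma$ and $\mathcal M:\mathcal H_\gamma\to\mathcal F_\alpha$ are well-defined linear bijections, and $$(\mathfrak B^\gamma_{RBF})^{-1}=(B_{2/\gamma^2})^{-1}\circ\mathcal M .$$ More precisely, for every $f\in\mathcal H_\gamma$, $$(\mathfrak B^\gamma_{RBF})^{-1}[f](x)=\Big(\frac{2}{\pi\gamma^2}\Big)^{1/4}\int_{\mathbb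 C}\overline{\mathcal A^\gamma_{RBF}(z,x)}\,f(z)\,d\mu_\gamma(z),$$ where the integral is the limit in $L^2(\mathbb R)$, as $r\to\infty$, of the integrals over $\{|z|\le r\}$; moreover, for almost every $x\in\mathbb R$, if the integral converges absolutely at $x$, then the formula holds at $x$ with the ordinary Lebesgue integral. -/

import Mathlib

open MeasureTheory Filter Topology ComplexConjugate

noncomputable section

/-- The Gaussian measure `(α / π) exp (-α |z|²) dA(z)` on `ℂ`. -/
def fockMeasure (α : ℝ) : Measure ℂ :=
  volume.withDensity fun z => ENNReal.ofReal (α / Real.pi * Real.exp (-α * ‖z‖ ^ 2))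

/-- The normalized RBF measure `(2 / (π γ²)) exp ((z - conj z)² / γ²) dA(z)` on `ℂ`.
The number `(z - conj z)² = -4 (Im z)²` is real, so taking its real part changes nothing. -/
def rbfMeasure (γ : ℝ) : Measure ℂ :=
  volume.withDensity fun z =>
    ENNReal.ofReal (2 / (Real.pi * γ ^ 2) * Real.exp (((z - conj z) ^ 2).re / γ ^ 2))

/-- The entire functions that are square integrable for `μ`. -/
def entireL2 (μ : Measure ℂ) : Submodule ℂ (ℂ → ℂ) where
  carrier := {f | Differentiable ℂ f ∧ MemLp f 2 μ}
  add_mem' hf hg := ⟨hf.1.add hg.1, hf.2.add hg.2⟩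
  zero_mem' := ⟨differentiable_const 0, MemLp.zero'⟩
  smul_mem' c _ hf := ⟨hf.1.const_smul c, hf.2.const_smul c⟩

/-- The Fock space `F_α`. -/
def fockSpace (α : ℝ) : Submodule ℂ (ℂ → ℂ) := entireL2 (fockMeasure α)

/-- The RBF space `H_γ`. -/
def rbfSpace (γ : ℝ) : Submodule ℂ (ℂ → ℂ) := entireL2 (rbfMeasure γ)

/-- The classical Segal–Bargmann kernel `exp (-(α/2)(z² + x²) + √2 α z x)`. -/
def segalBargmannKernel (α : ℝ) (z : ℂ) (x : ℝ) : ℂ :=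
  Complex.exp (-((α : ℂ) / 2) * (z ^ 2 + (x : ℂ) ^ 2) + (Real.sqrt 2 : ℂ) * α * z * x)

/-- The classical (unitarily normalized) Segal–Bargmann transform
`B_α φ (z) = (α / π)^{1/4} ∫ A_SB(z, x) φ(x) dx`. -/
def segalBargmann (α : ℝ) (φ : Lp ℂ 2 (volume : Measure ℝ)) (z : ℂ) : ℂ :=
  (((α / Real.pi) ^ ((1 : ℝ) / 4) : ℝ) : ℂ) * ∫ x : ℝ, segalBargmannKernel α z x * φ x

/-- The functions `e_n(z) = √(2^n / (γ^{2n} n!)) z^n exp (-z² / γ²)`. -/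
def rbfBasis (γ : ℝ) (n : ℕ) (z : ℂ) : ℂ :=
  (Real.sqrt (2 ^ n / (γ ^ (2 * n) * n.factorial)) : ℂ) * z ^ n *
    Complex.exp (-(z ^ 2 / (γ : ℂ) ^ 2))

/-- The `L²(ℝ)`-normalized Hermite functions with parameter `α`. In terms of the probabilists'
Hermite polynomials `He_n` of Mathlib, where `H_n(y) = 2^{n/2} He_n(√2 y)`, they are
`(α / π)^{1/4} (2^n n!)^{-1/2} H_n(√α x) exp (-α x² / 2)
  = (α / π)^{1/4} (n!)^{-1/2} He_n(√(2 α) x) exp (-α x² / 2)`. -/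
def hermiteFunction (α : ℝ) (n : ℕ) (x : ℝ) : ℝ :=
  (α / Real.pi) ^ ((1 : ℝ) / 4) / Real.sqrt n.factorial *
    Polynomial.aeval (Real.sqrt (2 * α) * x) (Polynomial.hermite n) *
    Real.exp (-(α * x ^ 2 / 2))

/-- The generating function `∑ e_n(z) ψ_n(x)`, with `ψ_n` the normalized Hermite functions with
parameter `2 / γ²`. -/
def rbfGeneratingKernel (γ : ℝ) (z : ℂ) (x : ℝ) : ℂ :=
  ∑' n : ℕ, rbfBasis γ n z * (hermiteFunction (2 / γ ^ 2) n x : ℂ)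

/-- The RBF Segal–Bargmann transform, the integral operator whose kernel is the generating
function. -/
def rbfSegalBargmann (γ : ℝ) (φ : Lp ℂ 2 (volume : Measure ℝ)) (z : ℂ) : ℂ :=
  ∫ x : ℝ, rbfGeneratingKernel γ z x * φ x

/-- The explicit kernel `A_RBF(z, x) = exp (-(x - √2 z)² / γ²)`. -/
def rbfKernel (γ : ℝ) (z : ℂ) (x : ℝ) : ℂ :=
  Complex.exp (-(((x : ℂ) - (Real.sqrt 2 : ℂ) * z) ^ 2 / (γ : ℂ) ^ 2))

end

/-! Write `R` for the transform with kernel `rbfConst γ * rbfKernel γ z x`. The kernel is the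
Hermite generating series because the Gaussians in `z` and `x` complete its exponent to a square.

On a vertical line `z = u + iv`, `R φ` is, up to a phase and the factor `exp (2 v² / γ²)`, the
Fourier transform of `φ` multiplied by a Gaussian window centred at `√2 u`. The weight of
`rbfMeasure` cancels the squared modulus of that factor, so Plancherel in `v` followed by
integration of the window over `u` shows that `R` is an isometry
(`lintegral_enorm_rbfTransform_sq`). Hence `R* R = 1`.

For surjectivity onto the entire functions, `R` sends the conjugate kernel at `w` to `K_w(z) = exp
(-(z - conj w)² / γ²)`. Translating by `w` turns the pairing with `K_w` into a radial Gaussian mean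
of an entire function, and the mean value property makes `K_w` a reproducing kernel
(`rbfSpace_reproducing`). Therefore `R (R* f) (w) = ⟨K_w, f⟩ = f w`, and the inverse of `R` is its
adjoint.

The adjoint is an explicit integral on functions cut off to a disc, by Fubini; its boundedness gives
the `L²` limit, and a sequence of radii gives the almost everywhere statement. Finally,
multiplication by `exp (z² / γ²)` carries one weight and one kernel to the other, so the claims
about `B_α` follow by composition. -/

/-! ### Generating function of the Hermite polynomials -/

/-- The iterated derivatives of `exp (x t - t² / 2)` are Hermite polynomials times it. -/
theorem iteratedDeriv_exp_hermite (x : ℂ) (n : ℕ) :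
    iteratedDeriv n (fun t : ℂ => Complex.exp (x * t - t ^ 2 / 2)) =
      fun t => Polynomial.aeval (x - t) (Polynomial.hermite n) *
        Complex.exp (x * t - t ^ 2 / 2) := by
  induction n with
  | zero => ext t; simp
  | succ n ih =>
    rw [iteratedDeriv_succ, ih]
    ext t
    have h1 : HasDerivAt (fun t : ℂ => Complex.exp (x * t - t ^ 2 / 2))
        (Complex.exp (x * t - t ^ 2 / 2) * (x - t)) t := by
      have : HasDerivAt (fun t : ℂ => x * t - t ^ 2 / 2) (x - t) t := by
        convert! ((hasDerivAt_id t).const_mul x).sub (((hasDerivAt_id t).pow 2).div_const 2) using 1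
        simp
      exact this.cexp
    have h2 : HasDerivAt (fun t : ℂ => Polynomial.aeval (x - t) (Polynomial.hermite n))
        (Polynomial.aeval (x - t) (Polynomial.derivative (Polynomial.hermite n)) * (-1)) t := by
      have := (Polynomial.hasDerivAt_aeval (Polynomial.hermite n) (x - t))
      exact this.comp t ((hasDerivAt_id t).const_sub x)
    refine (h2.fun_mul h1).deriv.trans ?_
    rw [Polynomial.hermite_succ]
    simp only [map_sub, map_mul, Polynomial.aeval_X]
    ring

/-- The generating function of the Hermite polynomials. -/
theorem hasSum_hermite (x t : ℂ) :
    HasSum (fun n : ℕ => t ^ n / n.factorial * Polynomial.aeval x (Polynomial.hermite n))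
      (Complex.exp (x * t - t ^ 2 / 2)) := by
  have hd : Differentiable ℂ (fun t : ℂ => Complex.exp (x * t - t ^ 2 / 2)) := by fun_prop
  refine (Complex.hasSum_taylorSeries_of_entire hd 0 t).congr_fun fun n => ?_
  rw [iteratedDeriv_exp_hermite]
  simp [div_eq_inv_mul, mul_assoc]

/-! ### Plancherel for Fourier integrals -/

theorem eLpNorm_two_sq {X E : Type*} [MeasurableSpace X] [NormedAddCommGroup E] (f : X → E)
    (μ : Measure X) : eLpNorm f 2 μ ^ 2 = ∫⁻ x, ‖f x‖ₑ ^ 2 ∂μ := by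
  have := eLpNorm_nnreal_pow_eq_lintegral (f := f) (μ := μ) (p := 2) (by norm_num)
  simpa only [NNReal.coe_ofNat, ENNReal.rpow_ofNat, ENNReal.coe_ofNat] using this

open FourierTransform SchwartzMap in
/-- The `L²` Fourier transform of an integrable function is its Fourier integral. -/
theorem MeasureTheory.MemLp.fourier_toLp_ae_eq {f : ℝ → ℂ} (h1 : Integrable f) (h2 : MemLp f 2) :
    (𝓕 (h2.toLp f) : Lp ℂ 2 (volume : Measure ℝ)) =ᵐ[volume] 𝓕 f := by
  have hc : Continuous (𝓕 f) := VectorFourier.fourierIntegral_continuous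
    Real.continuous_fourierChar (by exact continuous_inner) h1
  -- Both sides are tested against smooth compactly supported functions: the `L²` transform agrees
  -- with the distributional one, and for integrable `f` Fubini moves the Fourier integral onto the
  -- test function.
  refine ae_eq_of_integral_contDiff_smul_eq ?_ hc.locallyIntegrable fun g hg hs => ?_
  · exact (Lp.memLp _).locallyIntegrable (by norm_num)
  have hg' : ContDiff ℝ (⊤ : ℕ∞) (fun x => (g x : ℂ)) := Complex.ofRealCLM.contDiff.comp hg
  have hs' : HasCompactSupport (fun x => (g x : ℂ)) := hs.comp_left Complex.ofReal_zero
  let G : 𝓢(ℝ, ℂ) := hs'.toSchwartzMap hg'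
  have hG (x) : G x = (g x : ℂ) := rfl
  have key := DFunLike.congr_fun (Lp.fourier_toTemperedDistribution_eq (h2.toLp f)) G
  rw [TemperedDistribution.fourier_apply, Lp.toTemperedDistribution_apply,
    Lp.toTemperedDistribution_apply] at key
  have self : ∫ ξ, 𝓕 f ξ • G ξ = ∫ x, f x • 𝓕 (G : ℝ → ℂ) x := by
    simpa using! VectorFourier.integral_fourierIntegral_smul_eq_flip (μ := volume) (ν := volume)
      (L := innerₗ ℝ) Real.continuous_fourierChar (by exact continuous_inner) h1 G.integrable
  calc ∫ x, g x • (𝓕 (h2.toLp f) : Lp ℂ 2 (volume : Measure ℝ)) x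
      = ∫ x, G x • (𝓕 (h2.toLp f) : Lp ℂ 2 (volume : Measure ℝ)) x := by
        simp only [hG, Complex.real_smul, smul_eq_mul]
    _ = ∫ x, (𝓕 G) x • h2.toLp f x := key.symm
    _ = ∫ x, f x • 𝓕 (G : ℝ → ℂ) x := by
        refine integral_congr_ae ?_
        filter_upwards [h2.coeFn_toLp] with x hx
        rw [hx, SchwartzMap.fourier_coe, smul_eq_mul, smul_eq_mul, mul_comm]
    _ = ∫ x, g x • 𝓕 f x := by
        rw [← self]
        simp only [hG, Complex.real_smul, smul_eq_mul, mul_comm]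

/-- **Plancherel's theorem** for integrable, square integrable functions. -/
theorem lintegral_enorm_fourier_sq {f : ℝ → ℂ} (h1 : Integrable f) (h2 : MemLp f 2) :
    ∫⁻ ξ, ‖FourierTransform.fourier f ξ‖ₑ ^ 2 = ∫⁻ x, ‖f x‖ₑ ^ 2 := by
  rw [← eLpNorm_two_sq, ← eLpNorm_two_sq, ← eLpNorm_congr_ae (h2.fourier_toLp_ae_eq h1),
    ← eLpNorm_congr_ae h2.coeFn_toLp, ← Lp.enorm_def, ← Lp.enorm_def]
  congr 1
  rw [← ofReal_norm, ← ofReal_norm, Lp.norm_fourier_eq]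

/-! ### Gaussian means of entire functions -/

/-- This is the mean value property on a circle, with the angle running over the interval used by
polar coordinates. -/
theorem setIntegral_polarCoord_symm_of_differentiable {g : ℂ → ℂ} (hg : Differentiable ℂ g)
    (r : ℝ) : ∫ θ in Set.Ioo (-Real.pi) Real.pi, g (Complex.polarCoord.symm (r, θ)) =
      2 * Real.pi * g 0 := by
  have h := (hg.diffContOnCl (s := Metric.ball 0 |r|)).circleAverage
  rw [Real.circleAverage_eq_integral_add (-Real.pi),
    intervalIntegral.integral_comp_add_right (fun θ => g (circleMap 0 r θ))] at h
  rw [← integral_Ioc_eq_integral_Ioo,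
    ← intervalIntegral.integral_of_le (by linarith [Real.pi_pos]), ← h]
  have e : 2 * Real.pi + -Real.pi = Real.pi := by ring
  have e' (θ : ℝ) : Complex.polarCoord.symm (r, θ) = circleMap 0 r θ := by
    simp [circleMap, Complex.exp_mul_I]
  simp only [e, e', zero_add, Complex.real_smul, Complex.ofReal_inv, Complex.ofReal_mul,
    Complex.ofReal_ofNat]
  have := Real.pi_ne_zero
  field_simp

/-- The Gaussian mean of an entire function is its value at the centre. -/
theorem integral_mul_exp_neg_sq_of_differentiable {g : ℂ → ℂ} (hg : Differentiable ℂ g) {a : ℝ}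
    (ha : 0 < a) (hi : Integrable fun s => g s * Real.exp (-a * ‖s‖ ^ 2)) :
    ∫ s, g s * Real.exp (-a * ‖s‖ ^ 2) = g 0 * (Real.pi / a) := by
  have hcont : Continuous fun p : ℝ × ℝ => Complex.polarCoord.symm p := by
    simp only [Complex.polarCoord_symm_apply]; fun_prop
  have hint : IntegrableOn (fun p : ℝ × ℝ => p.1 • (g (Complex.polarCoord.symm p) *
      Real.exp (-a * ‖Complex.polarCoord.symm p‖ ^ 2))) (Set.Ioi 0 ×ˢ Set.Ioo (-Real.pi) Real.pi)
      (volume.prod volume) := by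
    have hgc := hg.continuous
    refine ⟨(by fun_prop : Continuous _).aestronglyMeasurable, ?_⟩
    have h := hi.2
    rw [hasFiniteIntegral_iff_enorm, ← Complex.lintegral_comp_polarCoord_symm] at h
    rw [hasFiniteIntegral_iff_enorm]
    refine lt_of_eq_of_lt ?_ h
    refine setLIntegral_congr_fun (measurableSet_Ioi.prod measurableSet_Ioo) fun p hp => ?_
    simp only [enorm_smul, smul_eq_mul]
    rw [Real.enorm_of_nonneg (le_of_lt hp.1)]
  rw [← Complex.integral_comp_polarCoord_symm, polarCoord_target]
  refine (setIntegral_prod _ hint).trans ?_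
  have inner (r : ℝ) : ∫ θ in Set.Ioo (-Real.pi) Real.pi, (r • (g (Complex.polarCoord.symm (r, θ)) *
      Real.exp (-a * ‖Complex.polarCoord.symm (r, θ)‖ ^ 2))) =
      (r * Complex.exp (-a * r ^ 2)) * (2 * Real.pi * g 0) := by
    rw [← setIntegral_polarCoord_symm_of_differentiable hg r, ← integral_const_mul]
    congr with θ
    simp only [Complex.norm_polarCoord_symm, sq_abs, Complex.real_smul]
    push_cast
    ring
  simp only [inner]
  rw [integral_mul_const, integral_mul_cexp_neg_mul_sq (by simpa using ha)]
  have : (a : ℂ) ≠ 0 := by exact_mod_cast ha.ne'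
  field_simp

/-! ### The explicit kernel: series, bounds, holomorphy -/

/-- The normalizing constant of the RBF transform. -/
noncomputable def rbfConst (γ : ℝ) : ℝ := (2 / (Real.pi * γ ^ 2)) ^ ((1 : ℝ) / 4)

/-- The RBF transform with the explicit kernel. -/
noncomputable def rbfTransform (γ : ℝ) (φ : ℝ → ℂ) (z : ℂ) : ℂ :=
  rbfConst γ * ∫ x : ℝ, rbfKernel γ z x * φ x

theorem rbfConst_sq (γ : ℝ) : rbfConst γ ^ 2 = Real.sqrt (2 / (Real.pi * γ ^ 2)) := by
  rw [rbfConst, ← Real.rpow_natCast, ← Real.rpow_mul (by positivity), Real.sqrt_eq_rpow]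
  norm_num

theorem rbfConst_nonneg (γ : ℝ) : 0 ≤ rbfConst γ := by unfold rbfConst; positivity

/-- The Hermite generating function is used at the point `2 x / γ` with parameter `√2 z / γ`.
Multiplied by the Gaussians `exp (-z² / γ²)` and `exp (-x² / γ²)`, its exponent becomes `-(x - √2
z)² / γ²`. -/
theorem hasSum_rbfBasis_mul_hermiteFunction {γ : ℝ} (hγ : 0 < γ) (z : ℂ) (x : ℝ) :
    HasSum (fun n : ℕ => rbfBasis γ n z * (hermiteFunction (2 / γ ^ 2) n x : ℂ))
      (rbfConst γ * rbfKernel γ z x) := by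
  have h2 : (Real.sqrt 2 : ℂ) ^ 2 = 2 := by
    rw [← Complex.ofReal_pow, Real.sq_sqrt (by norm_num)]; norm_num
  have hγ' : (γ : ℂ) ≠ 0 := by exact_mod_cast hγ.ne'
  have hs := (hasSum_hermite ((2 / γ * x : ℝ) : ℂ) (Real.sqrt 2 * z / γ)).mul_left
    (rbfConst γ * Complex.exp (-(z ^ 2 / (γ : ℂ) ^ 2)) * Complex.exp (-(x ^ 2 / (γ : ℂ) ^ 2)))
  have hval : (rbfConst γ * Complex.exp (-(z ^ 2 / (γ : ℂ) ^ 2)) *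
      Complex.exp (-(x ^ 2 / (γ : ℂ) ^ 2))) * Complex.exp (((2 / γ * x : ℝ) : ℂ) *
        (Real.sqrt 2 * z / γ) - (Real.sqrt 2 * z / γ) ^ 2 / 2) = rbfConst γ * rbfKernel γ z x := by
    rw [rbfKernel, mul_assoc, mul_assoc, ← Complex.exp_add, ← Complex.exp_add]
    congr 2
    push_cast
    field_simp
    linear_combination z ^ 2 * h2
  rw [hval] at hs
  refine hs.congr_fun fun n => ?_
  have e1 : Real.sqrt (2 ^ n / (γ ^ (2 * n) * n.factorial)) =
      Real.sqrt 2 ^ n / γ ^ n / Real.sqrt n.factorial := by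
    rw [Real.sqrt_div (by positivity), Real.sqrt_mul (by positivity), pow_mul',
      Real.sqrt_sq (by positivity), div_div]
    congr 1
    rw [Real.sqrt_eq_iff_mul_self_eq (by positivity) (by positivity), ← mul_pow,
      Real.mul_self_sqrt (by norm_num)]
  have e2 : Real.sqrt (2 * (2 / γ ^ 2)) = 2 / γ := by
    rw [show 2 * (2 / γ ^ 2) = (2 / γ) ^ 2 by ring, Real.sqrt_sq (by positivity)]
  have e3 : (2 / γ ^ 2 / Real.pi) ^ ((1 : ℝ) / 4) = rbfConst γ := by
    rw [rbfConst, div_div, mul_comm]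
  have e4 : (((Polynomial.aeval (2 / γ * x)) (Polynomial.hermite n) : ℝ) : ℂ) =
      (Polynomial.aeval ((2 / γ * x : ℝ) : ℂ)) (Polynomial.hermite n) := by
    have := Polynomial.aeval_algebraMap_apply (A := ℝ) ℂ (2 / γ * x) (Polynomial.hermite n)
    simpa using this.symm
  have e5 : (Real.sqrt n.factorial : ℂ) ^ 2 = n.factorial := by
    rw [← Complex.ofReal_pow, Real.sq_sqrt (by positivity)]; norm_num
  have e6 : (Real.sqrt n.factorial : ℂ) ≠ 0 := by
    exact_mod_cast (Real.sqrt_pos.2 (by positivity)).ne'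
  have e7 : -(2 / γ ^ 2 * x ^ 2 / 2) = -(x ^ 2 / γ ^ 2) := by ring
  rw [rbfBasis, hermiteFunction, e1, e2, e3, e7]
  simp only [Complex.ofReal_mul, Complex.ofReal_div, Complex.ofReal_exp, Complex.ofReal_neg,
    Complex.ofReal_pow] at e4 ⊢
  rw [e4, ← e5, div_pow, mul_pow]
  field_simp

theorem rbfGeneratingKernel_eq {γ : ℝ} (hγ : 0 < γ) (z : ℂ) (x : ℝ) :
    rbfGeneratingKernel γ z x = rbfConst γ * rbfKernel γ z x :=
  (hasSum_rbfBasis_mul_hermiteFunction hγ z x).tsum_eq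

theorem rbfSegalBargmann_eq {γ : ℝ} (hγ : 0 < γ) (φ : Lp ℂ 2 (volume : Measure ℝ)) :
    rbfSegalBargmann γ φ = rbfTransform γ φ := by
  ext z
  simp only [rbfSegalBargmann, rbfTransform, rbfGeneratingKernel_eq hγ, mul_assoc]
  rw [integral_const_mul]

theorem rbfKernel_continuous (γ : ℝ) :
    Continuous fun p : ℂ × ℝ => rbfKernel γ p.1 p.2 := by
  unfold rbfKernel; fun_prop

theorem norm_rbfKernel (γ : ℝ) (z : ℂ) (x : ℝ) :
    ‖rbfKernel γ z x‖ = Real.exp ((2 * z.im ^ 2 - (x - Real.sqrt 2 * z.re) ^ 2) / γ ^ 2) := by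
  have h2 : Real.sqrt 2 ^ 2 = 2 := Real.sq_sqrt (by norm_num)
  rw [rbfKernel, Complex.norm_exp]
  congr 1
  rw [← Complex.ofReal_pow, Complex.neg_re, Complex.div_ofReal_re, ← neg_div]
  congr 1
  simp only [sq, Complex.mul_re, Complex.sub_re, Complex.sub_im, Complex.ofReal_re,
    Complex.ofReal_im, Complex.mul_im]
  linear_combination z.im ^ 2 * h2

/-- A bound that is locally uniform in `z` and Gaussian in `x`; it serves for square integrability,
for differentiation under the integral and for Fubini. -/
theorem norm_rbfKernel_le (γ : ℝ) (z : ℂ) (x : ℝ) :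
    ‖rbfKernel γ z x‖ ≤
      Real.exp (2 * ‖z‖ ^ 2 / γ ^ 2) * Real.exp (-(1 / (2 * γ ^ 2)) * x ^ 2) := by
  have h2 : Real.sqrt 2 ^ 2 = 2 := Real.sq_sqrt (by norm_num)
  rw [norm_rbfKernel, ← Real.exp_add, Complex.sq_norm, Complex.normSq_apply]
  gcongr
  have : 2 * (z.re * z.re + z.im * z.im) / γ ^ 2 + -(1 / (2 * γ ^ 2)) * x ^ 2 =
    (2 * (z.re * z.re + z.im * z.im) - x ^ 2 / 2) / γ ^ 2 := by ring
  rw [this]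
  refine div_le_div_of_nonneg_right ?_ (by positivity)
  -- The two sides differ by `(x - 2 √2 Re z)² / 2`.
  nlinarith [sq_nonneg (x - 2 * Real.sqrt 2 * z.re)]

theorem memLp_two_exp_neg_mul_sq {b : ℝ} (hb : 0 < b) :
    MemLp (fun x : ℝ => Real.exp (-b * x ^ 2)) 2 := by
  rw [memLp_two_iff_integrable_sq (by fun_prop)]
  refine (integrable_exp_neg_mul_sq (b := 2 * b) (by positivity)).congr (ae_of_all _ fun x => ?_)
  simp only [← Real.exp_nat_mul]
  congr 1
  push_cast
  ring

theorem memLp_rbfKernel {γ : ℝ} (hγ : 0 < γ) (z : ℂ) : MemLp (rbfKernel γ z) 2 :=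
  ((memLp_two_exp_neg_mul_sq (b := 1 / (2 * γ ^ 2)) (by positivity)).const_mul
    (Real.exp (2 * ‖z‖ ^ 2 / γ ^ 2))).of_le
    (((rbfKernel_continuous γ).comp (by fun_prop : Continuous fun x : ℝ => (z, x))
      ).aestronglyMeasurable) (ae_of_all _ fun x =>
        (norm_rbfKernel_le γ z x).trans (le_abs_self _))

theorem integrable_rbfKernel_mul {γ : ℝ} (hγ : 0 < γ) (z : ℂ) {φ : ℝ → ℂ} (hφ : MemLp φ 2) :
    Integrable fun x => rbfKernel γ z x * φ x :=
  (memLp_rbfKernel hγ z).integrable_mul hφ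

theorem differentiable_rbfTransform {γ : ℝ} (hγ : 0 < γ) {φ : ℝ → ℂ} (hφ : MemLp φ 2) :
    Differentiable ℂ (rbfTransform γ φ) := by
  intro z₀
  refine DifferentiableAt.const_mul ?_ _
  set R := ‖z₀‖ + 1
  have hR : 0 ≤ R := by positivity
  -- Half of the exponent in `norm_rbfKernel_le`. One factor `exp (-b x²)` absorbs the linear factor
  -- produced by differentiating the kernel; the other stays as an `L²` function to pair with `φ`.
  set b := 1 / (4 * γ ^ 2) with hb
  have hb0 : 0 < b := by positivity
  set C := Real.exp (2 * R ^ 2 / γ ^ 2) * (2 * Real.sqrt 2 / γ ^ 2) * (1 + Real.sqrt 2 * R + 1 / b)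
  have hk (z : ℂ) (x : ℝ) : HasDerivAt (fun z => rbfKernel γ z x)
      (rbfKernel γ z x * (2 * Real.sqrt 2 * (x - Real.sqrt 2 * z) / (γ : ℂ) ^ 2)) z := by
    have : HasDerivAt (fun z : ℂ => -(((x : ℂ) - (Real.sqrt 2 : ℂ) * z) ^ 2 / (γ : ℂ) ^ 2))
        (2 * Real.sqrt 2 * (x - Real.sqrt 2 * z) / (γ : ℂ) ^ 2) z := by
      convert! (((((hasDerivAt_id z).const_mul (Real.sqrt 2 : ℂ)).const_sub (x : ℂ)).pow 2).div_const
        ((γ : ℂ) ^ 2)).neg using 1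
      simp
      ring
    exact this.cexp
  have key := hasDerivAt_integral_of_dominated_loc_of_deriv_le (μ := volume)
    (F := fun z x => rbfKernel γ z x * φ x)
    (F' := fun z x => rbfKernel γ z x * (2 * Real.sqrt 2 * (x - Real.sqrt 2 * z) / (γ : ℂ) ^ 2) * φ x)
    (x₀ := z₀) (s := Metric.ball z₀ 1) (bound := fun x => C * (Real.exp (-b * x ^ 2) * ‖φ x‖))
    (Metric.ball_mem_nhds z₀ one_pos) ?_ ?_ ?_ ?_ ?_ ?_
  · exact key.2.differentiableAt
  · exact Eventually.of_forall fun z => (integrable_rbfKernel_mul hγ z hφ).aestronglyMeasurable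
  · exact integrable_rbfKernel_mul hγ z₀ hφ
  · refine AEStronglyMeasurable.mul (Continuous.aestronglyMeasurable ?_) hφ.aestronglyMeasurable
    have := (rbfKernel_continuous γ).comp (by fun_prop : Continuous fun x : ℝ => (z₀, x))
    exact this.mul (by fun_prop)
  · refine ae_of_all _ fun x z hz => ?_
    have hzR : ‖z‖ ≤ R := by
      have := norm_sub_norm_le z z₀
      have h3 : ‖z - z₀‖ < 1 := by simpa [dist_eq_norm] using hz
      simp only [R]; linarith
    have hpow : Real.exp (-(1 / (2 * γ ^ 2)) * x ^ 2) =
        Real.exp (-b * x ^ 2) * Real.exp (-b * x ^ 2) := by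
      rw [← Real.exp_add, hb]; congr 1; ring
    -- The constant comes from `|x| ≤ 1 + x²` and `1 + b x² ≤ exp (b x²)`.
    have hx : (|x| + Real.sqrt 2 * R) * Real.exp (-b * x ^ 2) ≤ 1 + Real.sqrt 2 * R + 1 / b := by
      rw [neg_mul, Real.exp_neg, ← div_eq_mul_inv, div_le_iff₀ (Real.exp_pos _)]
      have h1 : b * x ^ 2 + 1 ≤ Real.exp (b * x ^ 2) := Real.add_one_le_exp _
      have h4 : |x| ≤ 1 + x ^ 2 := by nlinarith [sq_abs x, sq_nonneg (|x| - 1)]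
      have h5 : x ^ 2 = 1 / b * (b * x ^ 2) := by field_simp
      have h6 : 0 ≤ 1 / b := by positivity
      have h7 : 0 ≤ Real.sqrt 2 * R := by positivity
      have h8 : 0 ≤ b * x ^ 2 := by positivity
      nlinarith [mul_le_mul_of_nonneg_left h1 h6, mul_le_mul_of_nonneg_left h1 h7]
    have hlin : ‖2 * Real.sqrt 2 * (x - Real.sqrt 2 * z) / (γ : ℂ) ^ 2‖ ≤
        2 * Real.sqrt 2 / γ ^ 2 * (|x| + Real.sqrt 2 * R) := by
      rw [norm_div, norm_mul, norm_mul, norm_pow, Complex.norm_real, Complex.norm_real,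
        Real.norm_of_nonneg (Real.sqrt_nonneg _), Real.norm_of_nonneg hγ.le, Complex.norm_ofNat,
        mul_div_right_comm]
      gcongr
      refine (norm_sub_le _ _).trans ?_
      rw [norm_mul, Complex.norm_real, Complex.norm_real,
        Real.norm_of_nonneg (Real.sqrt_nonneg _), Real.norm_eq_abs]
      gcongr
    calc ‖rbfKernel γ z x * (2 * Real.sqrt 2 * (x - Real.sqrt 2 * z) / (γ : ℂ) ^ 2) * φ x‖
        ≤ (Real.exp (2 * R ^ 2 / γ ^ 2) * (Real.exp (-b * x ^ 2) * Real.exp (-b * x ^ 2))) *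
          (2 * Real.sqrt 2 / γ ^ 2 * (|x| + Real.sqrt 2 * R)) * ‖φ x‖ := by
          rw [norm_mul, norm_mul, ← hpow]
          gcongr
          refine (norm_rbfKernel_le γ z x).trans ?_
          gcongr
      _ = Real.exp (2 * R ^ 2 / γ ^ 2) * (2 * Real.sqrt 2 / γ ^ 2) *
          ((|x| + Real.sqrt 2 * R) * Real.exp (-b * x ^ 2)) * (Real.exp (-b * x ^ 2) * ‖φ x‖) := by
          ring
      _ ≤ C * (Real.exp (-b * x ^ 2) * ‖φ x‖) := by
          simp only [C]
          gcongr
  · exact ((memLp_two_exp_neg_mul_sq hb0).integrable_mul hφ.norm).const_mul C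
  · exact ae_of_all _ fun x z _ => (hk z x).mul_const _

/-! ### Isometry, by Plancherel on vertical lines -/

theorem lintegral_comp_mul_left (f : ℝ → ENNReal) {a : ℝ} (ha : a ≠ 0) :
    ∫⁻ x, f (a * x) = ENNReal.ofReal |a⁻¹| * ∫⁻ x, f x := by
  rw [← smul_eq_mul, ← lintegral_smul_measure, ← Real.map_volume_mul_left ha]
  exact ((Homeomorph.mulLeft₀ a ha).measurableEmbedding.lintegral_map f).symm

theorem measurable_rbfWeight (γ : ℝ) : Measurable fun z : ℂ =>
    ENNReal.ofReal (2 / (Real.pi * γ ^ 2) * Real.exp (((z - conj z) ^ 2).re / γ ^ 2)) := by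
  refine ENNReal.measurable_ofReal.comp (Continuous.measurable ?_)
  have : Continuous (fun z : ℂ => conj z) := Complex.continuous_conj
  fun_prop

theorem re_sub_conj_sq (z : ℂ) : ((z - conj z) ^ 2).re = -(4 * z.im ^ 2) := by
  simp [sq, Complex.mul_re]; ring

/-- Along vertical lines the RBF kernel is a modulated Gaussian times a Fourier character. -/
theorem rbfKernel_eq_fourierChar (γ u v x : ℝ) (hγ : 0 < γ) :
    rbfKernel γ (u + v * Complex.I) x =
      Complex.exp (((2 * v ^ 2 / γ ^ 2 : ℝ) : ℂ) + ((-(4 * u * v / γ ^ 2) : ℝ) : ℂ) * Complex.I) *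
      (Complex.exp (((-2 * Real.pi * x * (-Real.sqrt 2 / (Real.pi * γ ^ 2) * v) : ℝ) : ℂ) * Complex.I) *
        Real.exp (-((x - Real.sqrt 2 * u) ^ 2 / γ ^ 2))) := by
  have h2 : (Real.sqrt 2 : ℂ) ^ 2 = 2 := by
    rw [← Complex.ofReal_pow, Real.sq_sqrt (by norm_num)]; norm_num
  have hγ' : (γ : ℂ) ≠ 0 := by exact_mod_cast hγ.ne'
  have hpi : (Real.pi : ℂ) ≠ 0 := by exact_mod_cast Real.pi_ne_zero
  rw [rbfKernel, Complex.ofReal_exp, ← Complex.exp_add, ← Complex.exp_add]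
  congr 1
  push_cast
  field_simp
  ring_nf
  simp only [h2, Complex.I_sq]
  ring

/-- The Gaussian window makes `φ` integrable as well as square integrable, so Plancherel applies to
its Fourier integral. -/
theorem memLp_exp_neg_sub_sq_mul {γ : ℝ} (hγ : 0 < γ) (u : ℝ) {φ : ℝ → ℂ} (hφ : MemLp φ 2) :
    Integrable (fun x => (Real.exp (-((x - u) ^ 2 / γ ^ 2)) : ℂ) * φ x) ∧
    MemLp (fun x => (Real.exp (-((x - u) ^ 2 / γ ^ 2)) : ℂ) * φ x) 2 := by
  have h : MemLp (fun x => Real.exp (-((x - u) ^ 2 / γ ^ 2))) 2 := by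
    have := (memLp_two_exp_neg_mul_sq (b := 1 / γ ^ 2) (by positivity)).comp_measurePreserving
      (measurePreserving_sub_right volume u)
    refine this.congr_norm (by fun_prop) (ae_of_all _ fun x => ?_)
    simp only [Function.comp]
    congr 2
    ring
  refine ⟨(h.ofReal (K := ℂ)).integrable_mul hφ, hφ.of_le
    ((by fun_prop : Continuous _).aestronglyMeasurable.mul hφ.1) (ae_of_all _ fun x => ?_)⟩
  rw [norm_mul, Complex.norm_real, Real.norm_of_nonneg (Real.exp_pos _).le]
  refine mul_le_of_le_one_left (norm_nonneg _) (Real.exp_le_one_iff.2 ?_)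
  have : 0 ≤ (x - u) ^ 2 / γ ^ 2 := by positivity
  linarith

theorem rbfTransform_eq_fourier {γ : ℝ} (hγ : 0 < γ) (φ : ℝ → ℂ) (u v : ℝ) :
    rbfTransform γ φ (u + v * Complex.I) = rbfConst γ *
      (Complex.exp (((2 * v ^ 2 / γ ^ 2 : ℝ) : ℂ) + ((-(4 * u * v / γ ^ 2) : ℝ) : ℂ) * Complex.I) *
      FourierTransform.fourier (fun x : ℝ =>
        (Real.exp (-((x - Real.sqrt 2 * u) ^ 2 / γ ^ 2)) : ℂ) * φ x)
        (-Real.sqrt 2 / (Real.pi * γ ^ 2) * v)) := by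
  rw [rbfTransform, Real.fourier_real_eq_integral_exp_smul]
  congr 1
  rw [← integral_const_mul]
  refine integral_congr_ae (ae_of_all _ fun x => ?_)
  simp only
  rw [rbfKernel_eq_fourierChar γ u v x hγ, smul_eq_mul]
  ring

/-- The weight `exp (-4 v² / γ²)` cancels the square of `exp (2 v² / γ²)`, which leaves a dilated
Fourier transform for Plancherel. The dilation contributes `π γ² / √2`, which against the prefactor
`2 / (π γ²)` gives `√2`. -/
theorem lintegral_rbfTransform_vertical {γ : ℝ} (hγ : 0 < γ) {φ : ℝ → ℂ} (hφ : MemLp φ 2) (u : ℝ) :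
    ∫⁻ v : ℝ, ENNReal.ofReal (2 / (Real.pi * γ ^ 2) * Real.exp (-(4 * v ^ 2) / γ ^ 2)) *
      ‖rbfTransform γ φ (u + v * Complex.I)‖ₑ ^ 2 =
    ENNReal.ofReal (Real.sqrt 2 * rbfConst γ ^ 2) * ∫⁻ x : ℝ,
      ENNReal.ofReal (Real.exp (-(2 * (x - Real.sqrt 2 * u) ^ 2 / γ ^ 2))) * ‖φ x‖ₑ ^ 2 := by
  have hc := rbfConst_nonneg γ
  set G : ℝ → ℂ := fun x => (Real.exp (-((x - Real.sqrt 2 * u) ^ 2 / γ ^ 2)) : ℂ) * φ x with hG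
  set κ := -Real.sqrt 2 / (Real.pi * γ ^ 2) with hκ
  have hκ0 : κ < 0 := by
    rw [hκ, neg_div]
    have : 0 < Real.sqrt 2 / (Real.pi * γ ^ 2) := by positivity
    linarith
  obtain ⟨h1, h2⟩ := memLp_exp_neg_sub_sq_mul hγ (Real.sqrt 2 * u) hφ
  have e1 (v : ℝ) : ENNReal.ofReal (2 / (Real.pi * γ ^ 2) * Real.exp (-(4 * v ^ 2) / γ ^ 2)) *
      ‖rbfTransform γ φ (u + v * Complex.I)‖ₑ ^ 2 =
      ENNReal.ofReal (2 / (Real.pi * γ ^ 2) * rbfConst γ ^ 2) *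
        ‖FourierTransform.fourier G (κ * v)‖ₑ ^ 2 := by
    rw [rbfTransform_eq_fourier hγ, enorm_mul, enorm_mul, mul_pow, mul_pow,
      ← ofReal_norm (Complex.exp _), Complex.norm_exp, ← ofReal_norm (rbfConst γ : ℂ),
      Complex.norm_real, Real.norm_of_nonneg hc, ← ENNReal.ofReal_pow hc,
      ← ENNReal.ofReal_pow (Real.exp_pos _).le, ← mul_assoc, ← mul_assoc,
      ← ENNReal.ofReal_mul (by positivity), ← ENNReal.ofReal_mul (by positivity)]
    congr 2
    rw [← Real.exp_nat_mul, mul_right_comm, mul_assoc (2 / _), ← Real.exp_add, mul_assoc (2 / _)]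
    have : -(4 * v ^ 2) / γ ^ 2 + ((2 : ℕ) : ℝ) * (((2 * v ^ 2 / γ ^ 2 : ℝ) : ℂ) +
      ((-(4 * u * v / γ ^ 2) : ℝ) : ℂ) * Complex.I).re = 0 := by
      simp [-Complex.ofReal_div, -Complex.ofReal_mul, -Complex.ofReal_neg]; ring
    rw [this]
    simp
  have e2 (x : ℝ) : ‖G x‖ₑ ^ 2 =
      ENNReal.ofReal (Real.exp (-(2 * (x - Real.sqrt 2 * u) ^ 2 / γ ^ 2))) * ‖φ x‖ₑ ^ 2 := by
    rw [hG, enorm_mul, mul_pow, ← ofReal_norm (Complex.ofReal _), Complex.norm_real,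
      Real.norm_of_nonneg (Real.exp_pos _).le, ← ENNReal.ofReal_pow (Real.exp_pos _).le,
      ← Real.exp_nat_mul]
    congr 3
    push_cast; ring
  simp only [e1]
  rw [lintegral_const_mul' _ _ ENNReal.ofReal_ne_top,
    lintegral_comp_mul_left (fun ξ => ‖FourierTransform.fourier G ξ‖ₑ ^ 2) hκ0.ne,
    lintegral_enorm_fourier_sq h1 h2, ← mul_assoc, ← ENNReal.ofReal_mul (by positivity)]
  rw [lintegral_congr e2]
  congr 2
  rw [abs_of_neg (inv_lt_zero.2 hκ0), hκ]
  have h3 : Real.sqrt 2 ^ 2 = 2 := Real.sq_sqrt (by norm_num)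
  have := Real.pi_pos
  field_simp
  rw [h3, mul_comm]

theorem lintegral_exp_neg_sub_sq {γ : ℝ} (hγ : 0 < γ) (x : ℝ) :
    ∫⁻ u : ℝ, ENNReal.ofReal (Real.exp (-(2 * (x - Real.sqrt 2 * u) ^ 2 / γ ^ 2))) =
      ENNReal.ofReal (Real.sqrt (Real.pi * γ ^ 2 / 4)) := by
  have h2 : Real.sqrt 2 ^ 2 = 2 := Real.sq_sqrt (by norm_num)
  have e (u : ℝ) : ENNReal.ofReal (Real.exp (-(2 * (x - Real.sqrt 2 * u) ^ 2 / γ ^ 2))) =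
      (fun u => ENNReal.ofReal (Real.exp (-(4 / γ ^ 2) * u ^ 2))) (u - x / Real.sqrt 2) := by
    simp only
    congr 2
    field_simp
    rw [h2]; ring
  rw [lintegral_congr e, lintegral_sub_right_eq_self
    (fun u => ENNReal.ofReal (Real.exp (-(4 / γ ^ 2) * u ^ 2))), ← ofReal_integral_eq_lintegral_ofReal
    (integrable_exp_neg_mul_sq (by positivity)) (ae_of_all _ fun _ => (Real.exp_pos _).le),
    integral_gaussian]
  congr 2
  field_simp

theorem lintegral_rbfMeasure (γ : ℝ) {h : ℂ → ENNReal} (hh : Measurable h) :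
    ∫⁻ z, h z ∂(rbfMeasure γ) = ∫⁻ u : ℝ, ∫⁻ v : ℝ,
      ENNReal.ofReal (2 / (Real.pi * γ ^ 2) * Real.exp (-(4 * v ^ 2) / γ ^ 2)) *
        h (u + v * Complex.I) := by
  rw [rbfMeasure, lintegral_withDensity_eq_lintegral_mul _ (measurable_rbfWeight γ) hh,
    ← (Complex.volume_preserving_equiv_real_prod.symm).lintegral_comp
      ((measurable_rbfWeight γ).mul hh), Measure.volume_eq_prod, lintegral_prod]
  · refine lintegral_congr fun u => lintegral_congr fun v => ?_
    simp only [Pi.mul_apply, re_sub_conj_sq]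
    have : Complex.measurableEquivRealProd.symm (u, v) = u + v * Complex.I := by
      apply Complex.ext <;> simp
    simp [this]
  · exact (((measurable_rbfWeight γ).mul hh).comp
      Complex.measurableEquivRealProd.symm.measurable).aemeasurable

/-- The RBF transform is isometric. -/
theorem lintegral_enorm_rbfTransform_sq {γ : ℝ} (hγ : 0 < γ) {φ : ℝ → ℂ} (hφ : MemLp φ 2) :
    ∫⁻ z, ‖rbfTransform γ φ z‖ₑ ^ 2 ∂(rbfMeasure γ) = ∫⁻ x, ‖φ x‖ₑ ^ 2 := by
  have hm : Measurable fun z => ‖rbfTransform γ φ z‖ₑ ^ 2 :=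
    (differentiable_rbfTransform hγ hφ).continuous.measurable.enorm.pow_const 2
  rw [lintegral_rbfMeasure γ hm]
  simp only [lintegral_rbfTransform_vertical hγ hφ]
  rw [lintegral_const_mul' _ _ ENNReal.ofReal_ne_top, lintegral_lintegral_swap]
  · have (x : ℝ) : ∫⁻ u : ℝ, ENNReal.ofReal (Real.exp (-(2 * (x - Real.sqrt 2 * u) ^ 2 / γ ^ 2))) *
        ‖φ x‖ₑ ^ 2 = ENNReal.ofReal (Real.sqrt (Real.pi * γ ^ 2 / 4)) * ‖φ x‖ₑ ^ 2 := by
      rw [lintegral_mul_const' _ _ (by finiteness), lintegral_exp_neg_sub_sq hγ]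
    simp only [this]
    rw [lintegral_const_mul' _ _ ENNReal.ofReal_ne_top, ← mul_assoc,
      ← ENNReal.ofReal_mul (by positivity), rbfConst_sq, ← Real.sqrt_mul (by norm_num),
      ← Real.sqrt_mul (by positivity)]
    have : 2 * (2 / (Real.pi * γ ^ 2)) * (Real.pi * γ ^ 2 / 4) = 1 := by
      have := Real.pi_pos
      field_simp; norm_num
    simp [this]
  · have hcont : Continuous fun p : ℝ × ℝ =>
        ENNReal.ofReal (Real.exp (-(2 * (p.2 - Real.sqrt 2 * p.1) ^ 2 / γ ^ 2))) :=
      ENNReal.continuous_ofReal.comp (by fun_prop)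
    refine AEMeasurable.mul (μ := volume.prod volume) hcont.aemeasurable ?_
    · exact hφ.1.comp_snd.enorm.pow_const 2

theorem memLp_rbfTransform {γ : ℝ} (hγ : 0 < γ) {φ : ℝ → ℂ} (hφ : MemLp φ 2) :
    MemLp (rbfTransform γ φ) 2 (rbfMeasure γ) := by
  refine ⟨(differentiable_rbfTransform hγ hφ).continuous.aestronglyMeasurable, ?_⟩
  refine (ENNReal.pow_lt_top_iff.1 (?_ : _ ^ 2 < _)).resolve_right two_ne_zero
  rw [eLpNorm_two_sq,
    lintegral_enorm_rbfTransform_sq hγ hφ, ← eLpNorm_two_sq]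
  exact ENNReal.pow_lt_top hφ.2

theorem rbfTransform_mem_rbfSpace {γ : ℝ} (hγ : 0 < γ) {φ : ℝ → ℂ} (hφ : MemLp φ 2) :
    rbfTransform γ φ ∈ rbfSpace γ :=
  ⟨differentiable_rbfTransform hγ hφ, memLp_rbfTransform hγ hφ⟩

theorem rbfTransform_congr (γ : ℝ) {φ ψ : ℝ → ℂ} (h : φ =ᵐ[volume] ψ) :
    rbfTransform γ φ = rbfTransform γ ψ := by
  ext z
  simp only [rbfTransform]
  congr 1
  refine integral_congr_ae ?_
  filter_upwards [h] with x hx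
  rw [hx]

/-! ### The transform and its adjoint between `L²` spaces -/

/-- The RBF transform as a linear map into the RBF space. -/
noncomputable def rbfTransformLin {γ : ℝ} (hγ : 0 < γ) :
    Lp ℂ 2 (volume : Measure ℝ) →ₗ[ℂ] rbfSpace γ where
  toFun φ := ⟨rbfTransform γ φ, rbfTransform_mem_rbfSpace hγ (Lp.memLp φ)⟩
  map_add' φ ψ := by
    ext z
    change rbfTransform γ (φ + ψ : Lp ℂ 2 (volume : Measure ℝ)) z =
      rbfTransform γ φ z + rbfTransform γ ψ z
    rw [rbfTransform_congr γ (Lp.coeFn_add φ ψ)]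
    simp only [rbfTransform, Pi.add_apply, mul_add]
    rw [integral_add (integrable_rbfKernel_mul hγ z (Lp.memLp φ))
      (integrable_rbfKernel_mul hγ z (Lp.memLp ψ)), mul_add]
  map_smul' a φ := by
    ext z
    change rbfTransform γ (a • φ : Lp ℂ 2 (volume : Measure ℝ)) z = a * rbfTransform γ φ z
    rw [rbfTransform_congr γ (Lp.coeFn_smul a φ)]
    simp only [rbfTransform, Pi.smul_apply, smul_eq_mul, mul_left_comm _ a, integral_const_mul]

/-- The class in `L²` of a member of the RBF space. -/
noncomputable def rbfToLp (γ : ℝ) : rbfSpace γ →ₗ[ℂ] Lp ℂ 2 (rbfMeasure γ) where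
  toFun f := f.2.2.toLp f
  map_add' _ _ := rfl
  map_smul' _ _ := rfl

/-- The RBF transform as an isometry into `L²`. -/
noncomputable def rbfIsometry {γ : ℝ} (hγ : 0 < γ) :
    Lp ℂ 2 (volume : Measure ℝ) →ₗᵢ[ℂ] Lp ℂ 2 (rbfMeasure γ) where
  toLinearMap := rbfToLp γ ∘ₗ rbfTransformLin hγ
  norm_map' φ := by
    change ‖(memLp_rbfTransform hγ (Lp.memLp φ)).toLp _‖ = _
    rw [Lp.norm_toLp, Lp.norm_def]
    congr 1
    refine (ENNReal.pow_right_strictMono two_ne_zero).injective ?_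
    rw [eLpNorm_two_sq, eLpNorm_two_sq, lintegral_enorm_rbfTransform_sq hγ (Lp.memLp φ)]

theorem coeFn_rbfIsometry {γ : ℝ} (hγ : 0 < γ) (φ : Lp ℂ 2 (volume : Measure ℝ)) :
    rbfIsometry hγ φ =ᵐ[rbfMeasure γ] rbfTransform γ φ :=
  MemLp.coeFn_toLp (memLp_rbfTransform hγ (Lp.memLp φ))

/-- The adjoint of the RBF transform. -/
noncomputable def rbfAdjoint {γ : ℝ} (hγ : 0 < γ) :
    Lp ℂ 2 (rbfMeasure γ) →L[ℂ] Lp ℂ 2 (volume : Measure ℝ) :=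
  ContinuousLinearMap.adjoint (rbfIsometry hγ).toContinuousLinearMap

theorem inner_rbfAdjoint {γ : ℝ} (hγ : 0 < γ) (ψ : Lp ℂ 2 (volume : Measure ℝ))
    (F : Lp ℂ 2 (rbfMeasure γ)) :
    inner ℂ ψ (rbfAdjoint hγ F) = ∫ z, conj (rbfTransform γ ψ z) * F z ∂(rbfMeasure γ) := by
  rw [rbfAdjoint, ContinuousLinearMap.adjoint_inner_right, L2.inner_def]
  refine integral_congr_ae ?_
  filter_upwards [coeFn_rbfIsometry hγ ψ] with z hz
  simp only [LinearIsometry.coe_toContinuousLinearMap, RCLike.inner_apply, hz, mul_comm]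

theorem rbfAdjoint_rbfIsometry {γ : ℝ} (hγ : 0 < γ) (φ : Lp ℂ 2 (volume : Measure ℝ)) :
    rbfAdjoint hγ (rbfIsometry hγ φ) = φ := by
  refine ext_inner_left ℂ fun ψ => ?_
  rw [rbfAdjoint, ContinuousLinearMap.adjoint_inner_right]
  exact (rbfIsometry hγ).inner_map_map ψ φ

/-! ### Reproducing kernel and surjectivity -/

/-- The RBF transform of a conjugate kernel function is the reproducing kernel. -/
theorem rbfTransform_conj_rbfKernel {γ : ℝ} (hγ : 0 < γ) (z w : ℂ) :
    rbfTransform γ (fun x => rbfConst γ * conj (rbfKernel γ w x)) z =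
      Complex.exp (-((z - conj w) ^ 2 / (γ : ℂ) ^ 2)) := by
  have h2 : (Real.sqrt 2 : ℂ) ^ 2 = 2 := by
    rw [← Complex.ofReal_pow, Real.sq_sqrt (by norm_num)]; norm_num
  have hγ' : (γ : ℂ) ≠ 0 := by exact_mod_cast hγ.ne'
  have e (x : ℝ) : rbfKernel γ z x * (rbfConst γ * conj (rbfKernel γ w x)) = rbfConst γ *
      Complex.exp (((-(2 / γ ^ 2) : ℝ) : ℂ) * x ^ 2 +
        (2 * Real.sqrt 2 * (z + conj w) / (γ : ℂ) ^ 2) * x +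
        -(2 * (z ^ 2 + conj w ^ 2) / (γ : ℂ) ^ 2)) := by
    rw [mul_left_comm, rbfKernel, rbfKernel, ← Complex.exp_conj, ← Complex.exp_add]
    congr 2
    simp only [map_neg, map_div₀, map_pow, map_sub, map_mul, Complex.conj_ofReal]
    push_cast
    field_simp
    linear_combination (-(z ^ 2 + conj w ^ 2)) * h2
  simp only [rbfTransform, e]
  rw [integral_const_mul, integral_cexp_quadratic (by
    rw [Complex.ofReal_re]; have : 0 < 2 / γ ^ 2 := by positivity
    linarith), ← mul_assoc, ← mul_assoc, ← sq, ← Complex.ofReal_pow, rbfConst_sq]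
  have e3 : (Real.pi / -((-(2 / γ ^ 2) : ℝ) : ℂ)) ^ (1 / 2 : ℂ) =
      (Real.sqrt (Real.pi * γ ^ 2 / 2) : ℂ) := by
    rw [Real.sqrt_eq_rpow, Complex.ofReal_cpow (by positivity)]
    push_cast
    congr 1
    field_simp
  rw [e3, ← Complex.ofReal_mul, ← Real.sqrt_mul (by positivity)]
  have e4 : 2 / (Real.pi * γ ^ 2) * (Real.pi * γ ^ 2 / 2) = 1 := by
    have := Real.pi_pos
    field_simp
  rw [e4, Real.sqrt_one, Complex.ofReal_one, one_mul]
  congr 1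
  push_cast
  field_simp
  ring_nf
  simp only [h2]
  ring

theorem memLp_conj_rbfKernel {γ : ℝ} (hγ : 0 < γ) (w : ℂ) :
    MemLp (fun x => (rbfConst γ : ℂ) * conj (rbfKernel γ w x)) 2 :=
  ((memLp_rbfKernel hγ w).star).const_mul _

theorem integral_rbfMeasure (γ : ℝ) (f : ℂ → ℂ) :
    ∫ z, f z ∂(rbfMeasure γ) =
      ∫ z, ((2 / (Real.pi * γ ^ 2) * Real.exp (-(4 * z.im ^ 2) / γ ^ 2) : ℝ) : ℂ) * f z := by
  rw [rbfMeasure, integral_withDensity_eq_integral_toReal_smul (measurable_rbfWeight γ)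
    (ae_of_all _ fun _ => ENNReal.ofReal_lt_top)]
  simp only [re_sub_conj_sq]
  congr with z
  rw [ENNReal.toReal_ofReal (by positivity), Complex.real_smul]

theorem integrable_rbfMeasure_iff (γ : ℝ) (f : ℂ → ℂ) :
    Integrable f (rbfMeasure γ) ↔ Integrable fun z : ℂ =>
      ((2 / (Real.pi * γ ^ 2) * Real.exp (-(4 * z.im ^ 2) / γ ^ 2) : ℝ) : ℂ) * f z := by
  rw [rbfMeasure, integrable_withDensity_iff_integrable_smul' (measurable_rbfWeight γ)
    (ae_of_all _ fun _ => ENNReal.ofReal_lt_top)]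
  refine iff_of_eq (congrArg (fun g : ℂ → ℂ => Integrable g) (funext fun z => ?_))
  rw [re_sub_conj_sq, ENNReal.toReal_ofReal (by positivity), Complex.real_smul]

/-- The reproducing property of the RBF space. -/
theorem rbfSpace_reproducing {γ : ℝ} (hγ : 0 < γ) (f : rbfSpace γ) (w : ℂ) :
    ∫ z, conj (Complex.exp (-((z - conj w) ^ 2 / (γ : ℂ) ^ 2))) * (f : ℂ → ℂ) z ∂(rbfMeasure γ) =
      (f : ℂ → ℂ) w := by
  have hγ' : (γ : ℂ) ≠ 0 := by exact_mod_cast hγ.ne'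
  have hpi : (Real.pi : ℂ) ≠ 0 := by exact_mod_cast Real.pi_ne_zero
  have hint : Integrable (fun z => conj (Complex.exp (-((z - conj w) ^ 2 / (γ : ℂ) ^ 2))) *
      (f : ℂ → ℂ) z) (rbfMeasure γ) := by
    -- The reproducing kernel is itself a transform, hence square integrable, and its product with
    -- `f` is integrable.
    have := memLp_rbfTransform hγ (memLp_conj_rbfKernel hγ w)
    rw [funext fun z => rbfTransform_conj_rbfKernel hγ z w] at this
    exact this.star.integrable_mul f.2.2
  -- With `z = s + w`, the exponents of the weight and of the conjugate kernel add up to `(s² + 2 s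
  -- (w - conj w) - 2 |s|²) / γ²`. The part that is holomorphic in `s` goes into `g`; a radial
  -- Gaussian remains, and `g 0` is a multiple of `f w`.
  set g : ℂ → ℂ := fun s => (2 / (Real.pi * γ ^ 2)) *
    ((f : ℂ → ℂ) (s + w) * Complex.exp ((s ^ 2 + 2 * s * (w - conj w)) / (γ : ℂ) ^ 2)) with hg
  have hgd : Differentiable ℂ g := by
    have hf := f.2.1
    have : Differentiable ℂ fun s => (f : ℂ → ℂ) (s + w) := hf.comp (by fun_prop)
    fun_prop
  have key (s : ℂ) : ((2 / (Real.pi * γ ^ 2) *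
      Real.exp (-(4 * (s + w).im ^ 2) / γ ^ 2) : ℝ) : ℂ) *
      (conj (Complex.exp (-(((s + w) - conj w) ^ 2 / (γ : ℂ) ^ 2))) * (f : ℂ → ℂ) (s + w)) =
      g s * Real.exp (-(2 / γ ^ 2) * ‖s‖ ^ 2) := by
    have e1 : ((-(4 * (s + w).im ^ 2) : ℝ) : ℂ) = ((s + w) - conj (s + w)) ^ 2 := by
      rw [Complex.sub_conj]; push_cast; rw [mul_pow, Complex.I_sq]; ring
    have e2 : ((‖s‖ ^ 2 : ℝ) : ℂ) = s * conj s := by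
      rw [Complex.mul_conj, Complex.normSq_eq_norm_sq]
    have e3 : Complex.exp (((-(4 * (s + w).im ^ 2) : ℝ) : ℂ) / (γ : ℂ) ^ 2) *
        Complex.exp (conj (-(((s + w) - conj w) ^ 2 / (γ : ℂ) ^ 2))) =
        Complex.exp ((s ^ 2 + 2 * s * (w - conj w)) / (γ : ℂ) ^ 2) *
          Complex.exp (-(2 / (γ : ℂ) ^ 2) * ((‖s‖ ^ 2 : ℝ) : ℂ)) := by
      rw [e1, e2, ← Complex.exp_add, ← Complex.exp_add]
      congr 1
      simp only [map_neg, map_div₀, map_pow, map_sub, map_add, Complex.conj_conj,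
        Complex.conj_ofReal]
      field_simp
      ring
    rw [← Complex.exp_conj, hg]
    simp only [Complex.ofReal_mul, Complex.ofReal_exp, Complex.ofReal_div, Complex.ofReal_pow,
      Complex.ofReal_neg, Complex.ofReal_ofNat] at e3 ⊢
    linear_combination (2 / (Real.pi * (γ : ℂ) ^ 2)) * (f : ℂ → ℂ) (s + w) * e3
  rw [integral_rbfMeasure, ← integral_add_right_eq_self _ w]
  simp only [key]
  rw [integral_mul_exp_neg_sq_of_differentiable hgd (by positivity)]
  · simp only [hg, zero_add]
    push_cast
    simp
    field_simp
  · have h := ((integrable_rbfMeasure_iff γ _).1 hint).comp_add_right w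
    simpa only [key] using h

/-- Every member of the RBF space is the transform of its image under the adjoint. -/
theorem rbfTransform_rbfAdjoint {γ : ℝ} (hγ : 0 < γ) (f : rbfSpace γ) :
    rbfTransform γ (rbfAdjoint hγ (rbfToLp γ f)) = f := by
  ext w
  -- Pairing with the conjugate kernel at `w` evaluates a transform at `w`; moved across the
  -- adjoint, the same pairing becomes the reproducing integral of `f`.
  have h := inner_rbfAdjoint hγ ((memLp_conj_rbfKernel hγ w).toLp _) (rbfToLp γ f)
  have hl : inner ℂ ((memLp_conj_rbfKernel hγ w).toLp _) (rbfAdjoint hγ (rbfToLp γ f)) =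
      rbfTransform γ (rbfAdjoint hγ (rbfToLp γ f)) w := by
    rw [L2.inner_def, rbfTransform, ← integral_const_mul]
    refine integral_congr_ae ?_
    filter_upwards [(memLp_conj_rbfKernel hγ w).coeFn_toLp] with x hx
    rw [hx, RCLike.inner_apply]
    simp
    ring
  rw [← hl, h, ← rbfSpace_reproducing hγ f w]
  refine integral_congr_ae ?_
  filter_upwards [f.2.2.coeFn_toLp] with z hz
  rw [rbfTransform_congr γ (memLp_conj_rbfKernel hγ w).coeFn_toLp,
    rbfTransform_conj_rbfKernel hγ]
  exact congrArg _ hz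

theorem rbfTransformLin_rbfAdjoint {γ : ℝ} (hγ : 0 < γ) (f : rbfSpace γ) :
    rbfTransformLin hγ (rbfAdjoint hγ (rbfToLp γ f)) = f :=
  Subtype.ext (rbfTransform_rbfAdjoint hγ f)

/-- The RBF transform as a linear equivalence; its inverse is the adjoint. -/
noncomputable def rbfEquiv {γ : ℝ} (hγ : 0 < γ) :
    Lp ℂ 2 (volume : Measure ℝ) ≃ₗ[ℂ] rbfSpace γ :=
  { rbfTransformLin hγ with
    invFun := fun f => rbfAdjoint hγ (rbfToLp γ f)
    left_inv := fun φ => rbfAdjoint_rbfIsometry hγ φ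
    right_inv := fun f => rbfTransformLin_rbfAdjoint hγ f }

/-! ### The inversion integral -/

instance isLocallyFiniteMeasure_rbfMeasure (γ : ℝ) : IsLocallyFiniteMeasure (rbfMeasure γ) := by
  refine IsLocallyFiniteMeasure.withDensity_ofReal ?_
  have : Continuous (fun z : ℂ => conj z) := Complex.continuous_conj
  fun_prop

/-- The inversion integral over a disc. -/
noncomputable def rbfDiscInverse (γ : ℝ) (f : ℂ → ℂ) (r x : ℝ) : ℂ :=
  rbfConst γ * ∫ z in Metric.closedBall (0 : ℂ) r, conj (rbfKernel γ z x) * f z ∂(rbfMeasure γ)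

/-- This licenses Fubini on a disc times a set of finite measure, where the kernel is bounded by
`exp (2 r² / γ²)`. -/
theorem integrable_conj_rbfKernel_mul_prod {γ : ℝ} {f : ℂ → ℂ} (hf : Continuous f)
    (r : ℝ) {s : Set ℝ} (hs : volume s < ⊤) :
    Integrable (fun p : ℂ × ℝ => conj (rbfKernel γ p.1 p.2) * f p.1)
      (((rbfMeasure γ).restrict (Metric.closedBall 0 r)).prod (volume.restrict s)) := by
  have : IsFiniteMeasure (volume.restrict s) := ⟨by simpa using hs⟩
  have hfi : IntegrableOn f (Metric.closedBall 0 r) (rbfMeasure γ) :=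
    hf.continuousOn.integrableOn_compact (isCompact_closedBall 0 r)
  refine ((hfi.comp_fst (volume.restrict s)).const_mul
    (Real.exp (2 * r ^ 2 / γ ^ 2) : ℂ)).mono ?_ ?_
  · have h1 := rbfKernel_continuous γ
    exact ((Complex.continuous_conj.comp h1).mul (hf.comp continuous_fst)).aestronglyMeasurable
  · have hmem : ∀ᵐ z ∂((rbfMeasure γ).restrict (Metric.closedBall 0 r)),
        z ∈ Metric.closedBall (0 : ℂ) r := ae_restrict_mem Metric.isClosed_closedBall.measurableSet
    filter_upwards [Measure.quasiMeasurePreserving_fst.ae hmem] with p hp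
    rw [norm_mul, norm_mul, RCLike.norm_conj, Complex.norm_real,
      Real.norm_of_nonneg (Real.exp_pos _).le]
    gcongr
    rw [mem_closedBall_zero_iff] at hp
    refine (norm_rbfKernel_le γ p.1 p.2).trans ?_
    refine (mul_le_of_le_one_right (Real.exp_pos _).le (Real.exp_le_one_iff.2 ?_)).trans ?_
    · have : 0 ≤ 1 / (2 * γ ^ 2) * p.2 ^ 2 := by positivity
      linarith
    · gcongr

/-- On functions cut off to a disc, the adjoint is given by the inversion integral. -/
theorem rbfAdjoint_indicator_ae_eq {γ : ℝ} (hγ : 0 < γ) (f : rbfSpace γ) (r : ℝ) :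
    rbfAdjoint hγ ((f.2.2.indicator
      (Metric.isClosed_closedBall (x := (0 : ℂ)) (ε := r)).measurableSet).toLp _) =ᵐ[volume]
      rbfDiscInverse γ f r := by
  have hball := (Metric.isClosed_closedBall (x := (0 : ℂ)) (ε := r)).measurableSet
  have hfc : Continuous (f : ℂ → ℂ) := f.2.1.continuous
  refine ae_eq_of_forall_setIntegral_eq_of_sigmaFinite (fun s hs hμ => ?_) (fun s hs hμ => ?_)
    fun s hs hμ => ?_
  · have : IsFiniteMeasure (volume.restrict s) := ⟨by simpa using hμ⟩
    exact ((Lp.memLp _).restrict s).integrable (by norm_num)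
  · exact (integrable_conj_rbfKernel_mul_prod hfc r hμ).integral_prod_right.const_mul _
  -- The integral over `s` is a pairing with the indicator of `s`; the adjoint moves it to the
  -- transform of that indicator, and Fubini then exchanges the integrals over `s` and over the
  -- disc.
  · rw [← L2.inner_indicatorConstLp_one hs hμ.ne, inner_rbfAdjoint]
    have h1 (z : ℂ) : conj (rbfTransform γ (indicatorConstLp 2 hs hμ.ne (1 : ℂ)) z) =
        rbfConst γ * ∫ x in s, conj (rbfKernel γ z x) := by
      rw [rbfTransform_congr γ indicatorConstLp_coeFn, rbfTransform, map_mul, Complex.conj_ofReal,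
        integral_conj, ← integral_indicator hs]
      congr 3
      ext x
      by_cases hx : x ∈ s <;> simp [hx]
    calc ∫ z, conj (rbfTransform γ (indicatorConstLp 2 hs hμ.ne (1 : ℂ)) z) *
          ((f.2.2.indicator hball).toLp _) z ∂(rbfMeasure γ)
        = ∫ z, (Metric.closedBall (0 : ℂ) r).indicator (fun z =>
            (rbfConst γ * ∫ x in s, conj (rbfKernel γ z x)) * (f : ℂ → ℂ) z) z ∂(rbfMeasure γ) := by
          refine integral_congr_ae ?_
          filter_upwards [(f.2.2.indicator hball).coeFn_toLp] with z hz
          rw [hz, h1]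
          by_cases hx : z ∈ Metric.closedBall (0 : ℂ) r
          · simp only [Set.indicator_of_mem hx]
          · simp only [Set.indicator_of_notMem hx, mul_zero]
      _ = rbfConst γ * ∫ z in Metric.closedBall (0 : ℂ) r, (∫ x in s,
            conj (rbfKernel γ z x) * (f : ℂ → ℂ) z) ∂(rbfMeasure γ) := by
          rw [integral_indicator hball, ← integral_const_mul]
          simp only [integral_mul_const, mul_assoc]
      _ = ∫ x in s, rbfDiscInverse γ f r x := by
          rw [integral_integral_swap (integrable_conj_rbfKernel_mul_prod hfc r hμ)]
          simp only [rbfDiscInverse, integral_const_mul]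

theorem tendsto_eLpNorm_sub_indicator_closedBall {μ : Measure ℂ} {f : ℂ → ℂ} (hf : MemLp f 2 μ) :
    Tendsto (fun r : ℝ => eLpNorm (f - (Metric.closedBall (0 : ℂ) r).indicator f) 2 μ)
      atTop (𝓝 0) := by
  have hball (r : ℝ) := (Metric.isClosed_closedBall (x := (0 : ℂ)) (ε := r)).measurableSet
  have h : Tendsto (fun r : ℝ => ∫⁻ z, ‖(f - (Metric.closedBall (0 : ℂ) r).indicator f) z‖ₑ ^ 2 ∂μ)
      atTop (𝓝 (∫⁻ _, 0 ∂μ)) := by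
    refine tendsto_lintegral_filter_of_dominated_convergence' (fun z => ‖f z‖ₑ ^ 2)
      (Eventually.of_forall fun r => ((hf.1.sub (hf.1.indicator (hball r))).enorm.pow_const 2))
      (Eventually.of_forall fun r => ae_of_all _ fun z => ?_) ?_ (ae_of_all _ fun z => ?_)
    · by_cases hz : z ∈ Metric.closedBall (0 : ℂ) r <;> simp [hz]
    · rw [← eLpNorm_two_sq]
      exact (ENNReal.pow_lt_top hf.2).ne
    · refine tendsto_const_nhds.congr' ?_
      filter_upwards [eventually_ge_atTop ‖z‖] with r hr
      have : z ∈ Metric.closedBall (0 : ℂ) r := by simpa using hr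
      simp [this]
  have h2 := (ENNReal.continuous_rpow_const (y := (1 / 2 : ℝ))).tendsto _ |>.comp h
  simp only [lintegral_zero] at h2
  rw [ENNReal.zero_rpow_of_pos (by norm_num)] at h2
  refine h2.congr fun r => ?_
  simp only [Function.comp]
  rw [← eLpNorm_two_sq, ← ENNReal.rpow_natCast, ← ENNReal.rpow_mul]
  norm_num

theorem norm_rbfAdjoint_le {γ : ℝ} (hγ : 0 < γ) (F : Lp ℂ 2 (rbfMeasure γ)) :
    ‖rbfAdjoint hγ F‖ ≤ ‖F‖ := by
  refine (ContinuousLinearMap.le_opNorm _ _).trans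
    (mul_le_of_le_one_left (norm_nonneg _) ?_)
  rw [rbfAdjoint, LinearIsometryEquiv.norm_map]
  exact (rbfIsometry hγ).norm_toContinuousLinearMap_le

/-- The error is the adjoint applied to `f` minus its truncation. The adjoint of an isometry is a
contraction, so the error is at most the `L²` norm of the tail of `f`. -/
theorem tendsto_eLpNorm_rbfEquiv_symm_sub {γ : ℝ} (hγ : 0 < γ) (f : rbfSpace γ) :
    Tendsto (fun r : ℝ => eLpNorm (fun x => (rbfEquiv hγ).symm f x - rbfDiscInverse γ f r x) 2
      volume) atTop (𝓝 0) := by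
  refine tendsto_of_tendsto_of_tendsto_of_le_of_le tendsto_const_nhds
    (tendsto_eLpNorm_sub_indicator_closedBall f.2.2) (fun _ => zero_le) fun r => ?_
  have hball := (Metric.isClosed_closedBall (x := (0 : ℂ)) (ε := r)).measurableSet
  set G := (f.2.2.indicator hball).toLp _
  have e : (fun x => (rbfEquiv hγ).symm f x - rbfDiscInverse γ f r x) =ᵐ[volume]
      rbfAdjoint hγ (rbfToLp γ f - G) := by
    rw [map_sub]
    filter_upwards [rbfAdjoint_indicator_ae_eq hγ f r,
      Lp.coeFn_sub (rbfAdjoint hγ (rbfToLp γ f)) (rbfAdjoint hγ G)] with x h1 h2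
    rw [h2, Pi.sub_apply, h1]
    rfl
  simp only
  rw [eLpNorm_congr_ae e, ← Lp.enorm_def]
  have e2 : rbfToLp γ f - G = (f.2.2.sub (f.2.2.indicator hball)).toLp _ :=
    (MemLp.toLp_sub f.2.2 (f.2.2.indicator hball)).symm
  calc ‖rbfAdjoint hγ (rbfToLp γ f - G)‖ₑ ≤ ‖rbfToLp γ f - G‖ₑ := by
        rw [← ofReal_norm, ← ofReal_norm]
        exact ENNReal.ofReal_le_ofReal (norm_rbfAdjoint_le hγ _)
    _ = _ := by
        rw [e2, Lp.enorm_toLp]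

theorem aestronglyMeasurable_rbfDiscInverse {γ : ℝ} (hγ : 0 < γ) (f : rbfSpace γ) (r : ℝ) :
    AEStronglyMeasurable (rbfDiscInverse γ f r) :=
  (Lp.aestronglyMeasurable _).congr (rbfAdjoint_indicator_ae_eq hγ f r)

/-- Convergence in `L²` implies convergence in measure, hence almost everywhere along some sequence
of radii. Where the integral converges absolutely, the disc integrals along that sequence tend to
the full integral, and limits are unique. -/
theorem rbfEquiv_symm_ae_eq {γ : ℝ} (hγ : 0 < γ) (f : rbfSpace γ) :
    ∀ᵐ x : ℝ, Integrable (fun z : ℂ => conj (rbfKernel γ z x) * (f : ℂ → ℂ) z) (rbfMeasure γ) →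
      (rbfEquiv hγ).symm f x =
        rbfConst γ * ∫ z : ℂ, conj (rbfKernel γ z x) * (f : ℂ → ℂ) z ∂(rbfMeasure γ) := by
  have hm : TendstoInMeasure volume (fun r => rbfDiscInverse γ f r) atTop
      ((rbfEquiv hγ).symm f) := by
    refine tendstoInMeasure_of_tendsto_eLpNorm (p := 2) two_ne_zero
      (fun r => aestronglyMeasurable_rbfDiscInverse hγ f r) (Lp.aestronglyMeasurable _) ?_
    refine (tendsto_eLpNorm_rbfEquiv_symm_sub hγ f).congr fun r => ?_
    exact eLpNorm_sub_comm _ _ _ _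
  obtain ⟨ns, hns, hlim⟩ := hm.exists_seq_tendsto_ae'
  filter_upwards [hlim] with x hx hint
  refine tendsto_nhds_unique hx ?_
  exact ((aecover_closedBall hns).integral_tendsto_of_countably_generated hint).const_mul _

/-! ### Passage to the Fock space -/

/-- The two weights match because `2 Re (z²) - 2 |z|² = -4 (Im z)²`. -/
theorem enorm_exp_sq_mul_sq (γ : ℝ) (hγ : 0 < γ) (f : ℂ → ℂ) (z : ℂ) :
    ENNReal.ofReal (2 / γ ^ 2 / Real.pi * Real.exp (-(2 / γ ^ 2) * ‖z‖ ^ 2)) *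
      ‖Complex.exp (z ^ 2 / (γ : ℂ) ^ 2) * f z‖ₑ ^ 2 =
    ENNReal.ofReal (2 / (Real.pi * γ ^ 2) * Real.exp (((z - conj z) ^ 2).re / γ ^ 2)) *
      ‖f z‖ₑ ^ 2 := by
  rw [enorm_mul, mul_pow, ← ofReal_norm (Complex.exp _), Complex.norm_exp,
    ← ENNReal.ofReal_pow (Real.exp_pos _).le, ← mul_assoc, ← ENNReal.ofReal_mul (by positivity),
    ← Real.exp_nat_mul, mul_assoc (_ / _), ← Real.exp_add, re_sub_conj_sq, div_div,
    mul_comm (γ ^ 2)]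
  congr 5
  rw [← Complex.ofReal_pow, Complex.div_ofReal_re, Complex.sq_norm, Complex.normSq_apply]
  simp only [sq, Complex.mul_re]
  push_cast
  ring

theorem lintegral_fockMeasure_exp_sq_mul {γ : ℝ} (hγ : 0 < γ) {f : ℂ → ℂ} (hf : Continuous f) :
    ∫⁻ z, ‖Complex.exp (z ^ 2 / (γ : ℂ) ^ 2) * f z‖ₑ ^ 2 ∂(fockMeasure (2 / γ ^ 2)) =
      ∫⁻ z, ‖f z‖ₑ ^ 2 ∂(rbfMeasure γ) := by
  rw [fockMeasure, rbfMeasure, lintegral_withDensity_eq_lintegral_mul _ (by fun_prop) (by fun_prop),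
    lintegral_withDensity_eq_lintegral_mul _ (measurable_rbfWeight γ) (by fun_prop)]
  exact lintegral_congr fun z => enorm_exp_sq_mul_sq γ hγ f z

theorem exp_sq_mul_mem_fockSpace_iff {γ : ℝ} (hγ : 0 < γ) {f : ℂ → ℂ} (hf : Differentiable ℂ f) :
    (fun z => Complex.exp (z ^ 2 / (γ : ℂ) ^ 2) * f z) ∈ fockSpace (2 / γ ^ 2) ↔
      f ∈ rbfSpace γ := by
  have hc := hf.continuous
  have h : eLpNorm (fun z => Complex.exp (z ^ 2 / (γ : ℂ) ^ 2) * f z) 2 (fockMeasure (2 / γ ^ 2)) =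
      eLpNorm f 2 (rbfMeasure γ) := by
    refine (ENNReal.pow_right_strictMono two_ne_zero).injective ?_
    rw [eLpNorm_two_sq, eLpNorm_two_sq]
    exact lintegral_fockMeasure_exp_sq_mul hγ hc
  constructor
  · exact fun hg => ⟨hf, hc.aestronglyMeasurable, h ▸ hg.2.2⟩
  · exact fun hg => ⟨by fun_prop, (by fun_prop : Continuous _).aestronglyMeasurable,
      h.symm ▸ hg.2.2⟩

/-- Multiplication by `exp (z² / γ²)` from the RBF space to the Fock space. -/
noncomputable def rbfToFock {γ : ℝ} (hγ : 0 < γ) : rbfSpace γ ≃ₗ[ℂ] fockSpace (2 / γ ^ 2) where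
  toFun f := ⟨fun z => Complex.exp (z ^ 2 / (γ : ℂ) ^ 2) * (f : ℂ → ℂ) z,
    (exp_sq_mul_mem_fockSpace_iff hγ f.2.1).2 f.2⟩
  map_add' f g := by ext z; exact mul_add _ _ _
  map_smul' a f := by ext z; exact mul_left_comm _ _ _
  invFun g := ⟨fun z => Complex.exp (-(z ^ 2 / (γ : ℂ) ^ 2)) * (g : ℂ → ℂ) z, by
    have hg := g.2.1
    refine (exp_sq_mul_mem_fockSpace_iff hγ (by fun_prop)).1 ?_
    simp only [← mul_assoc, ← Complex.exp_add, add_neg_cancel, Complex.exp_zero, one_mul]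
    exact g.2⟩
  left_inv f := by
    ext z
    simp only [← mul_assoc, ← Complex.exp_add, neg_add_cancel, Complex.exp_zero, one_mul]
  right_inv g := by
    ext z
    simp only [← mul_assoc, ← Complex.exp_add, add_neg_cancel, Complex.exp_zero, one_mul]

/-- For `α = 2 / γ²` the two normalizing constants coincide, and the factor `exp (z² / γ²)` turns
the exponent `-(x - √2 z)² / γ²` into that of the Segal–Bargmann kernel. -/
theorem exp_sq_mul_rbfTransform {γ : ℝ} (hγ : 0 < γ) (φ : Lp ℂ 2 (volume : Measure ℝ)) (z : ℂ) :
    Complex.exp (z ^ 2 / (γ : ℂ) ^ 2) * rbfTransform γ φ z = segalBargmann (2 / γ ^ 2) φ z := by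
  have h2 : (Real.sqrt 2 : ℂ) ^ 2 = 2 := by
    rw [← Complex.ofReal_pow, Real.sq_sqrt (by norm_num)]; norm_num
  have hγ' : (γ : ℂ) ≠ 0 := by exact_mod_cast hγ.ne'
  have hc : (2 / γ ^ 2 / Real.pi) ^ ((1 : ℝ) / 4) = rbfConst γ := by
    rw [rbfConst, div_div, mul_comm]
  rw [segalBargmann, rbfTransform, mul_left_comm, ← integral_const_mul, hc]
  congr 2
  ext x
  rw [← mul_assoc, rbfKernel, segalBargmannKernel, ← Complex.exp_add]
  congr 2
  push_cast
  field_simp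
  linear_combination (-z ^ 2) * h2

theorem mainTheorem4 (γ : ℝ) (hγ : 0 < γ) :
    (∀ (z : ℂ) (x : ℝ),
      HasSum (fun n : ℕ => rbfBasis γ n z * (hermiteFunction (2 / γ ^ 2) n x : ℂ))
        ((((2 / (Real.pi * γ ^ 2)) ^ ((1 : ℝ) / 4) : ℝ) : ℂ) * rbfKernel γ z x)) ∧
    ∃ (B : Lp ℂ 2 (volume : Measure ℝ) ≃ₗ[ℂ] fockSpace (2 / γ ^ 2))
      (R : Lp ℂ 2 (volume : Measure ℝ) ≃ₗ[ℂ] rbfSpace γ)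
      (M : rbfSpace γ ≃ₗ[ℂ] fockSpace (2 / γ ^ 2)),
      (∀ φ, (B φ : ℂ → ℂ) = segalBargmann (2 / γ ^ 2) φ) ∧
      (∀ φ, (R φ : ℂ → ℂ) = rbfSegalBargmann γ φ) ∧
      (∀ f z, (M f : ℂ → ℂ) z = Complex.exp (z ^ 2 / (γ : ℂ) ^ 2) * (f : ℂ → ℂ) z) ∧
      (∀ f, R.symm f = B.symm (M f)) ∧
      (∀ f : rbfSpace γ,
        Tendsto
          (fun r : ℝ => eLpNorm
            (fun x : ℝ => R.symm f x -
              (((2 / (Real.pi * γ ^ 2)) ^ ((1 : ℝ) / 4) : ℝ) : ℂ) *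
                ∫ z in Metric.closedBall (0 : ℂ) r,
                  conj (rbfKernel γ z x) * (f : ℂ → ℂ) z ∂(rbfMeasure γ))
            2 volume)
          atTop (𝓝 0)) ∧
      (∀ f : rbfSpace γ, ∀ᵐ x : ℝ,
        Integrable (fun z : ℂ => conj (rbfKernel γ z x) * (f : ℂ → ℂ) z) (rbfMeasure γ) →
          R.symm f x =
            (((2 / (Real.pi * γ ^ 2)) ^ ((1 : ℝ) / 4) : ℝ) : ℂ) *
              ∫ z : ℂ, conj (rbfKernel γ z x) * (f : ℂ → ℂ) z ∂(rbfMeasure γ)) := by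
  -- `B` is taken to be `M ∘ R`, so its bijectivity and the identity of inverses are formal; the
  -- content is that this composite is the classical transform.
  refine ⟨hasSum_rbfBasis_mul_hermiteFunction hγ, (rbfEquiv hγ).trans (rbfToFock hγ), rbfEquiv hγ,
    rbfToFock hγ, fun φ => funext fun z => exp_sq_mul_rbfTransform hγ φ z,
    fun φ => (rbfSegalBargmann_eq hγ φ).symm, fun _ _ => rfl, fun f => ?_,
    tendsto_eLpNorm_rbfEquiv_symm_sub hγ, rbfEquiv_symm_ae_eq hγ⟩
  simp
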